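/- For $c\in(0,1/27)$ put $$g_2(c)=\tfrac1{12}-2c,\qquad g_3(c)=\tfrac c6-\tfrac1{216}-c^2 .$$ For every such $c$ there is exactly one pair $\omega_1=\omega_1(c)\in\mathbb R_{>0}$, $\omega_2=\omega_2(c)\in i\mathbb R_{>0}$ (the half-periods) such that the lattice $\Lambda_c=2\omega_1\mathbb Z+2\omega_2\mathbb Z$ has Weierstrass invariants $60\sum_{l\in\Lambda_c\setminus 0}l^{-4}=g_2(c)$ and $140\sum_{l\in\Lambda_c\setminus 0}l^{-6}=g_3(c)$. Let $$\zeta(z)=\frac1z+\sum_{l\in\Lambda_c\setminus0}\Big(\frac1{z-l}+\frac1l+\frac z{l^2}\Big)$$ be the Weierstrass zeta function of $\Lambda_c$, and let $\eta_i=\eta_i(c)=\zeta(\omega_i)$ be the quasi-periods, $i=1,2$. Then $\eta_i$ and $\omega_i$ are differentiable functions of $c\in(0,1/27)$, and for $i=1,2$ $$\frac{\partial}{\partial c}\begin{pmatrix}\eta_i\\ \omega_i\end{pmatrix}=\frac1{c(1-27c)}\begin{pmatrix}\frac14(1-36c)&\frac1{48}(1-24c)\\-3&-\frac14(1-36c)\end{pmatrix}\begin{pmatrix}\eta_i\\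 \omega_i\end{pmatrix},$$ where the matrix is traceless. Equivalently, with $\tilde\eta_i=\eta_i+\omega_i\left(\frac1{12}-3c\right)$, $$\frac{\partial\tilde\eta_i}{\partial c}=-2\omega_i,\qquad \frac{\partial\omega_i}{\partial c}=\frac{-3\,\tilde\eta_i}{c(1-27c)} .$$ -/

import Mathlib

namespace PeriodPair

/-- The Weierstrass zeta function of the period lattice,
`ζ(z) = 1/z + ∑_{l ≠ 0} (1/(z - l) + 1/l + z/l²)`.
The summand at `l = 0` is `1/z` because of the convention `x / 0 = 0`. -/
noncomputable def weierstrassZeta (L : PeriodPair) (z : ℂ) : ℂ :=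
  ∑' l : L.lattice, (1 / (z - (l : ℂ)) + 1 / (l : ℂ) + z / (l : ℂ) ^ 2)

/-- The half-periods `ω₁, ω₂` (indexed by `0, 1`) of the lattice generated by `2ω₁, 2ω₂`.
In Mathlib's `PeriodPair` the fields `L.ω₁`, `L.ω₂` are the full periods. -/
noncomputable def halfPeriod (L : PeriodPair) (i : Fin 2) : ℂ :=
  ![L.ω₁ / 2, L.ω₂ / 2] i

/-- The quasi-periods `η_i = ζ(ω_i)`. -/
noncomputable def quasiPeriod (L : PeriodPair) (i : Fin 2) : ℂ :=
  L.weierstrassZeta (L.halfPeriod i)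

/-- `L` is the rectangular period pair (`ω₁ ∈ ℝ_{>0}`, `ω₂ ∈ iℝ_{>0}`) with invariants
`g₂ = 1/12 - 2c` and `g₃ = c/6 - 1/216 - c²`. -/
structure IsRectangularFor (L : PeriodPair) (c : ℝ) : Prop where
  ω₁_im : L.ω₁.im = 0
  ω₁_re_pos : 0 < L.ω₁.re
  ω₂_re : L.ω₂.re = 0
  ω₂_im_pos : 0 < L.ω₂.im
  g₂_eq : L.g₂ = 1 / 12 - 2 * (c : ℂ)
  g₃_eq : L.g₃ = (c : ℂ) / 6 - 1 / 216 - (c : ℂ) ^ 2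

/-- The modified quasi-periods `η̃_i = η_i + ω_i (1/12 - 3c)`. -/
noncomputable def modifiedQuasiPeriod (L : PeriodPair) (c : ℝ) (i : Fin 2) : ℂ :=
  L.quasiPeriod i + L.halfPeriod i * (1 / 12 - 3 * (c : ℂ))

end PeriodPair

/-- The coefficient matrix of the linear system for `(η_i, ω_i)`. -/
noncomputable def periodMatrix (c : ℝ) : Matrix (Fin 2) (Fin 2) ℂ :=
  (1 / ((c : ℂ) * (1 - 27 * (c : ℂ)))) •
    !![(1 / 4) * (1 - 36 * (c : ℂ)), (1 / 48) * (1 - 24 * (c : ℂ));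
       -3, -((1 / 4) * (1 - 36 * (c : ℂ)))]

/-! For the lattice w(ℤz + ℤ), g₂ and g₃ are multiples of E₄(z)/w⁴ and E₆(z)/w⁶, and η₁ is a
multiple of E2(z)/w; the transformation of G2 under S gives the Legendre relation, hence η₂. A
rectangular lattice has z = it and w > 0, where the three series are real, so everything becomes
real calculus in (w, t).

Existence and uniqueness: eliminating w leaves one equation for t, namely E₆/E₄^(3/2) = 3√3
g₃/g₂^(3/2). The left side increases from -1 to 1 because the discriminant is positive on the axis
(`strictMonoOn_axisInvariant`); the right side lies in (-1, 1) because g₂³ - 27g₃² = c³(1 - 27c).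

Derivatives: the inverse function theorem makes t, and then w, differentiable in c. Ramanujan's
formulas for the derivatives of E2, E₄, E₆ turn the differentiated equations for g₂, g₃ into a
linear system for t′, w′ (`IsPeriodRatio.hasDerivAt`), and the quasi-periods follow. Ramanujan's
formulas hold because the difference of the two sides is a level one form of weight 4, 6 or 8
vanishing at the cusp, hence zero. -/

section Ramanujan

open UpperHalfPlane hiding I
open Complex ModularForm ModularFormClass SlashInvariantForm CuspFormClass Derivative
  EisensteinSeries Filter Topology MatrixGroups Manifold Function
open scoped Real

/-! ### Limits at the cusp and Ramanujan's differential equations -/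

theorem UpperHalfPlane.tendsto_atImInfty_of_hasSum_qExpansion {f : ℍ → ℂ} {c : ℕ → ℂ}
    (hf : ∀ τ : ℍ, HasSum (fun m ↦ c m • Periodic.qParam 1 τ ^ m) (f τ)) :
    Tendsto f atImInfty (𝓝 (c 0)) := by
  have hq (τ : ℍ) : Periodic.qParam 1 τ ≠ 0 := Periodic.qParam_ne_zero _
  -- The shifted series bounds (f - c 0)/q, and q tends to 0 at the cusp.
  have hb : IsBoundedAtImInfty fun τ ↦ (f τ - c 0) / Periodic.qParam 1 τ := by
    refine isBoundedAtImInfty_of_hasSum_qExpansion (c := fun m ↦ c (m + 1)) one_pos fun τ ↦ ?_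
    have h := (hasSum_nat_add_iff' 1).mpr (hf τ)
    simp only [Finset.range_one, Finset.sum_singleton, pow_zero, smul_eq_mul, mul_one] at h
    refine (h.div_const (Periodic.qParam 1 τ)).congr_fun ?_
    intro m
    rw [smul_eq_mul, pow_succ, ← mul_assoc, mul_div_cancel_right₀ _ (hq τ)]
  have h0 := (qParam_tendsto_atImInfty one_pos).zero_mul_isBoundedUnder_le
    hb.isBoundedUnder_le
  have h1 := h0.add_const (c 0)
  rw [zero_add] at h1
  refine h1.congr fun τ ↦ ?_
  rw [mul_div_cancel₀ _ (hq τ), sub_add_cancel]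

theorem EisensteinSeries.tendsto_E2_atImInfty : Tendsto E2 atImInfty (𝓝 1) := by
  have h := tendsto_atImInfty_of_hasSum_qExpansion (f := E2) (fun τ ↦ by
    simpa only [Periodic.qParam, ofReal_one, div_one] using hasSum_qExpansion_E2 τ)
  simpa using h

theorem EisensteinSeries.tendsto_E_atImInfty {k : ℕ} (hk : 3 ≤ k) (hk2 : Even k) :
    Tendsto (ModularForm.E hk) atImInfty (𝓝 1) := by
  have h := tendsto_atImInfty_of_hasSum_qExpansion fun τ ↦
    ModularForm.hasSum_qExpansion (ModularForm.E hk) one_pos one_mem_strictPeriods_SL τ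
  rwa [E_qExpansion_coeff_zero hk hk2] at h

/-- By the Cauchy estimate, the derivative of a bounded function vanishes at the cusp. -/
theorem Derivative.tendsto_normalizedDerivOfComplex_atImInfty {f : ℍ → ℂ} (hf : MDiff f)
    (hb : IsBoundedAtImInfty f) :
    Tendsto (normalizedDerivOfComplex f) atImInfty (𝓝 0) := by
  obtain ⟨M, A, hMA⟩ := isBoundedAtImInfty_iff.mp hb
  rw [UpperHalfPlane.mdifferentiable_iff] at hf
  -- The disc of this radius about τ stays above height max A 0 + 1/2: inside the half plane and
  -- where the bound M holds. Its radius grows with Im τ.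
  have key : ∀ τ : ℍ, max A 0 + 1 ≤ τ.im →
      ‖deriv (f ∘ ofComplex) τ‖ ≤ M / (τ.im - max A 0 - 1 / 2) := by
    intro τ hτ
    have hA : A ≤ max A 0 := le_max_left _ _
    have h0 : 0 ≤ max A 0 := le_max_right _ _
    have him : ∀ z ∈ Metric.closedBall (τ : ℂ) (τ.im - max A 0 - 1 / 2),
        max A 0 + 1 / 2 ≤ z.im := by
      intro z hz
      have h1 := abs_im_le_norm ((τ : ℂ) - z)
      rw [Metric.mem_closedBall, dist_comm, dist_eq_norm] at hz
      have h2 := (le_abs_self _).trans (h1.trans hz)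
      rw [sub_im, coe_im] at h2
      linarith
    refine Complex.norm_deriv_le_of_forall_mem_sphere_norm_le (by linarith) ?_ ?_
    · refine DifferentiableOn.diffContOnCl_ball (U := {z : ℂ | 0 < z.im}) hf fun z hz ↦ ?_
      have := him z hz
      change 0 < z.im
      linarith
    · intro z hz
      have h1 := him z (Metric.sphere_subset_closedBall hz)
      have h2 : 0 < z.im := by linarith
      rw [Function.comp_apply, ofComplex_apply_of_im_pos h2]
      exact hMA _ (show A ≤ z.im by linarith)
  have hlim : Tendsto (fun τ : ℍ ↦ M / (τ.im - max A 0 - 1 / 2)) atImInfty (𝓝 0) := by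
    refine Tendsto.comp (g := fun x : ℝ ↦ M / (x - max A 0 - 1 / 2)) (y := atTop) ?_ tendsto_comap
    refine Tendsto.const_div_atTop ?_ _
    exact tendsto_atTop_add_const_right _ _ (tendsto_atTop_add_const_right _ _ tendsto_id)
  have hd : Tendsto (fun τ : ℍ ↦ deriv (f ∘ ofComplex) τ) atImInfty (𝓝 0) := by
    refine squeeze_zero_norm' ?_ hlim
    filter_upwards [tendsto_comap.eventually (eventually_ge_atTop (max A 0 + 1))] with τ hτ
    exact key τ hτ
  have h := hd.const_mul ((2 * π * Complex.I)⁻¹)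
  rwa [mul_zero] at h

/-- A level one form of weight less than `12` which vanishes at the cusp is zero. -/
theorem ModularForm.eq_zero_of_slash_eq_of_tendsto_zero {f : ℍ → ℂ} {k : ℤ} (hk : k < 12)
    (hd : MDiff f) (hf : ∀ γ : SL(2, ℤ), f ∣[k] γ = f) (h0 : Tendsto f atImInfty (𝓝 0)) :
    f = 0 := by
  let F : CuspForm 𝒮ℒ k :=
    { toFun := f
      slash_action_eq' := by
        rintro _ ⟨γ, rfl⟩
        exact hf γ
      holo' := hd
      -- Every cusp is an SL(2, ℤ)-translate of ∞ and f is invariant, so the limit at ∞ suffices.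
      zero_at_cusps' := fun hc ↦ by
        rw [Subgroup.IsArithmetic.isCusp_iff_isCusp_SL2Z] at hc
        rw [OnePoint.isZeroAt_iff_forall_SL2Z hc]
        intro γ _
        rw [hf]
        exact h0 }
  have hF : F = 0 := rank_zero_iff_forall_zero.mp (CuspForm.rank_eq_zero_of_weight_lt_twelve hk) F
  exact congrArg (fun G : CuspForm 𝒮ℒ k ↦ (G : ℍ → ℂ)) hF

theorem ModularForm.E_mdifferentiable {k : ℕ} (hk : 3 ≤ k) : MDiff (ModularForm.E hk) :=
  ModularFormClass.holo _

theorem ModularForm.E_slash {k : ℕ} (hk : 3 ≤ k) (γ : SL(2, ℤ)) :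
    (ModularForm.E hk : ℍ → ℂ) ∣[(k : ℤ)] γ = ModularForm.E hk :=
  SlashInvariantForm.slash_action_eqn _ _ (MonoidHom.mem_range.mpr ⟨γ, rfl⟩)

theorem Derivative.tendsto_serreDerivative_E {k : ℕ} (hk : 3 ≤ k) (hk2 : Even k) :
    Tendsto (serreDerivative k (ModularForm.E hk)) atImInfty (𝓝 (-k * 12⁻¹)) := by
  have h := (tendsto_normalizedDerivOfComplex_atImInfty (E_mdifferentiable hk)
    (ModularFormClass.bdd_at_infty (ModularForm.E hk))).sub
    ((tendsto_E2_atImInfty.const_mul ((k : ℂ) * 12⁻¹)).mul (tendsto_E_atImInfty hk hk2))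
  simpa using! h

/-- The Serre derivative of E₄ has weight 6 and limit -1/3 at the cusp, so adding E₆/3 gives a cusp
form of weight 6, which is zero. The formula for E₆ is the same argument in weight 8. -/
theorem Derivative.normalizedDerivOfComplex_E₄ (z : ℍ) :
    normalizedDerivOfComplex E₄ z = (E2 z * E₄ z - E₆ z) / 3 := by
  have h := ModularForm.eq_zero_of_slash_eq_of_tendsto_zero
    (f := serreDerivative (4 : ℕ) E₄ + (3 : ℂ)⁻¹ • ⇑E₆) (k := 6) (by norm_num)
    ((serreDerivative_mdifferentiable _ (E_mdifferentiable _)).add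
      ((E_mdifferentiable _).const_smul _)) ?_ ?_
  · have := congrFun h z
    simp only [Pi.add_apply, serreDerivative_apply, Pi.smul_apply, smul_eq_mul,
      Pi.zero_apply] at this
    push_cast at this
    linear_combination this
  · intro γ
    rw [SlashAction.add_slash, ModularForm.SL_smul_slash]
    congr 1
    · exact serreDerivative_slash_invariant (k := 4) (E_mdifferentiable _) (E_slash _ γ)
    · exact congrArg _ (E_slash (k := 6) _ γ)
  · have := (tendsto_serreDerivative_E (k := 4) (by norm_num) (by decide)).add
      ((tendsto_E_atImInfty (k := 6) (by norm_num) (by decide)).const_mul (3 : ℂ)⁻¹)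
    convert! this using 2
    norm_num

theorem Derivative.normalizedDerivOfComplex_E₆ (z : ℍ) :
    normalizedDerivOfComplex E₆ z = (E2 z * E₆ z - E₄ z ^ 2) / 2 := by
  have h := ModularForm.eq_zero_of_slash_eq_of_tendsto_zero
    (f := serreDerivative (6 : ℕ) E₆ + (2 : ℂ)⁻¹ • (⇑E₄ * ⇑E₄)) (k := 8) (by norm_num)
    ((serreDerivative_mdifferentiable _ (E_mdifferentiable _)).add
      (((E_mdifferentiable _).mul (E_mdifferentiable _)).const_smul _)) ?_ ?_
  · have := congrFun h z
    simp only [Pi.add_apply, serreDerivative_apply, Pi.smul_apply, smul_eq_mul,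
      Pi.zero_apply, Pi.mul_apply] at this
    push_cast at this
    linear_combination this
  · intro γ
    rw [SlashAction.add_slash, ModularForm.SL_smul_slash]
    congr 1
    · exact serreDerivative_slash_invariant (k := 6) (E_mdifferentiable _) (E_slash _ γ)
    · rw [show (8 : ℤ) = 4 + 4 by norm_num, ModularForm.mul_slash_SL2]
      exact congrArg (fun f : ℍ → ℂ ↦ (2 : ℂ)⁻¹ • (f * f)) (E_slash (k := 4) _ γ)
  · have := (tendsto_serreDerivative_E (k := 6) (by norm_num) (by decide)).add
      (((tendsto_E_atImInfty (k := 4) (by norm_num) (by decide)).mul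
        (tendsto_E_atImInfty (k := 4) (by norm_num) (by decide))).const_mul (2 : ℂ)⁻¹)
    convert! this using 2
    norm_num

theorem EisensteinSeries.D2_mdifferentiable (γ : SL(2, ℤ)) : MDiff (D2 γ) := by
  rw [UpperHalfPlane.mdifferentiable_iff]
  intro z hz
  have h := (hasDerivAt_denom_zpow (γ : GL (Fin 2) ℝ) (-1) ⟨z, hz⟩).const_mul
    (2 * π * Complex.I * γ 1 0)
  refine h.differentiableAt.differentiableWithinAt.congr_of_eventuallyEq ?_ ?_
  · filter_upwards [self_mem_nhdsWithin] with w hw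
    simp [D2, div_eq_mul_inv, ofComplex_apply_of_im_pos hw]
  · simp [D2, div_eq_mul_inv, ofComplex_apply_of_im_pos hz]

theorem Derivative.normalizedDerivOfComplex_D2 (γ : SL(2, ℤ)) (z : ℍ) :
    normalizedDerivOfComplex (D2 γ) z = -((γ 1 0 : ℂ) / denom γ z) ^ 2 := by
  have h := (hasDerivAt_denom_zpow (γ : GL (Fin 2) ℝ) (-1) z).const_mul
    (2 * π * Complex.I * γ 1 0)
  have h' : HasDerivAt (D2 γ ∘ ofComplex) _ (z : ℂ) := h.congr_of_eventuallyEq <| by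
    filter_upwards [isOpen_upperHalfPlaneSet.mem_nhds z.im_pos] with w hw
    simp [D2, div_eq_mul_inv, ofComplex_apply_of_im_pos hw]
  rw [normalizedDerivOfComplex, h'.deriv]
  have hz := denom_ne_zero (γ : GL (Fin 2) ℝ) z
  have h2 : (-1 - 1 : ℤ) = -(2 : ℕ) := by norm_num
  rw [h2, zpow_neg, zpow_natCast]
  simp
  field_simp
  rw [Complex.I_sq, neg_one_mul]

/-- E2 is only quasimodular: slashing by γ adds a multiple of κ = c/(cz + d), with (c, d) the lower
row of γ. Since the derivative of κ is a multiple of κ², the anomalies of the derivative of E2 and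
of E2²/12 cancel, leaving a form of weight 4. -/
theorem Derivative.normalizedDerivOfComplex_E2 (z : ℍ) :
    normalizedDerivOfComplex E2 z = (E2 z ^ 2 - E₄ z) / 12 := by
  have hE2 := E2_mdifferentiable
  have h := ModularForm.eq_zero_of_slash_eq_of_tendsto_zero
    (f := normalizedDerivOfComplex E2 - (12 : ℂ)⁻¹ • (E2 * E2) + (12 : ℂ)⁻¹ • ⇑E₄) (k := 4)
    (by norm_num)
    (((normalizedDerivOfComplex_mdifferentiable hE2).sub ((hE2.mul hE2).const_smul _)).add
      ((E_mdifferentiable _).const_smul _)) ?_ ?_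
  · have := congrFun h z
    simp only [Pi.add_apply, Pi.sub_apply, Pi.smul_apply, smul_eq_mul,
      Pi.zero_apply, Pi.mul_apply] at this
    linear_combination this
  · intro γ
    rw [SlashAction.add_slash, ModularForm.SL_smul_slash, sub_eq_add_neg, SlashAction.add_slash,
      SlashAction.neg_slash, ModularForm.SL_smul_slash]
    refine congrArg₂ _ ?_ (congrArg _ (E_slash (k := 4) _ γ))
    have h1 := normalizedDerivOfComplex_SL_slash (k := 2) hE2 (γ := γ)
    have h2 := E2_slash_action γ
    have h3 : (E2 * E2) ∣[(4 : ℤ)] γ = (E2 ∣[(2 : ℤ)] γ) * (E2 ∣[(2 : ℤ)] γ) :=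
      ModularForm.mul_slash_SL2 2 2 γ E2 E2
    rw [h3]
    rw [h2, normalizedDerivOfComplex_sub _ _ hE2 ((D2_mdifferentiable γ).const_smul _),
      normalizedDerivOfComplex_smul _ _ (D2_mdifferentiable γ)] at h1
    rw [h2]
    ext w
    have h4 := congrFun h1 w
    simp only [Pi.sub_apply, Pi.smul_apply, smul_eq_mul, normalizedDerivOfComplex_D2, D2,
      riemannZeta_two, Pi.add_apply, Pi.neg_apply, Pi.mul_apply] at h4 ⊢
    have hpi : (π : ℂ) ≠ 0 := by exact_mod_cast Real.pi_ne_zero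
    have hI : Complex.I ≠ 0 := Complex.I_ne_zero
    have hd := denom_ne_zero (γ : GL (Fin 2) ℝ) w
    set κ := (γ 1 0 : ℂ) / denom γ w with hκ
    have hD : 2 * π * Complex.I * (γ 1 0 : ℂ) / denom γ w = 2 * π * Complex.I * κ := by
      rw [hκ, mul_div_assoc]
    rw [hD] at h4 ⊢
    have h5 : (normalizedDerivOfComplex E2 ∣[(4 : ℤ)] γ) w = normalizedDerivOfComplex E2 w +
        3 * κ ^ 2 / π ^ 2 + κ / (π * Complex.I) * (E2 w - 6 * Complex.I * κ / π) := by
      refine (sub_eq_iff_eq_add.mp h4.symm).trans ?_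
      push_cast
      field_simp
      ring
    rw [h5]
    field_simp
    ring_nf
    simp
  · have := ((tendsto_normalizedDerivOfComplex_atImInfty hE2 isBoundedAtImInfty_E2).sub
      ((tendsto_E2_atImInfty.mul tendsto_E2_atImInfty).const_mul (12 : ℂ)⁻¹)).add
      ((tendsto_E_atImInfty (k := 4) (by norm_num) (by decide)).const_mul (12 : ℂ)⁻¹)
    convert! this using 2
    norm_num

end Ramanujan

/-! ### Lattice sums: invariants and quasi-periods as Eisenstein series -/

section LatticeSums

open UpperHalfPlane hiding I
open Complex EisensteinSeries Filter Topology Function MatrixGroups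
open scoped Real

/-- Summability allows the sum to be computed along the intervals [-N, N), where it telescopes. -/
theorem hasSum_int_sub_succ_zero {F : ℤ → ℂ} (hs : Summable fun n ↦ F n - F (n + 1))
    (hp : Tendsto (fun N : ℕ ↦ F N) atTop (𝓝 0)) (hn : Tendsto (fun N : ℕ ↦ F (-N)) atTop (𝓝 0)) :
    HasSum (fun n ↦ F n - F (n + 1)) 0 := by
  have h1 : Tendsto (fun N : ℕ ↦ ∑ n ∈ Finset.Ico (-N : ℤ) N, (F n - F (n + 1))) atTop (𝓝 0) := by
    simp_rw [Finset.sum_Ico_int_sub]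
    simpa using hn.sub hp
  have h2 : Tendsto (fun N : ℕ ↦ Finset.Ico (-N : ℤ) N) atTop atTop := by
    refine tendsto_atTop_finset_of_monotone (fun a b hab ↦ ?_) fun x ↦ ⟨x.natAbs + 1, ?_⟩
    · exact Finset.Ico_subset_Ico (by omega) (by omega)
    · simp only [Finset.mem_Ico]
      omega
  have h3 := hs.hasSum
  rwa [tendsto_nhds_unique (h3.comp h2) h1] at h3

theorem tendsto_inv_const_sub_intCast (a : ℂ) {ι : Type*} {l : Filter ι} {u : ι → ℤ}
    (hu : Tendsto (fun i ↦ |(u i : ℝ)|) l atTop) :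
    Tendsto (fun i ↦ 1 / (a - (u i : ℂ))) l (𝓝 0) := by
  simp_rw [one_div]
  refine tendsto_inv₀_cobounded.comp ?_
  rw [← tendsto_norm_atTop_iff_cobounded]
  refine tendsto_atTop_mono (fun i ↦ ?_) (tendsto_atTop_add_const_right l (-‖a‖) hu)
  have := norm_sub_norm_le ((u i : ℂ)) a
  rw [norm_sub_rev, Complex.norm_intCast] at this
  linarith

namespace PeriodPair

/-- Away from l = 0 and l = z the summand is z²/(l²(z - l)), and a²b ≤ a³ + b³ separates the two
factors. -/
theorem summable_weierstrassZeta (L : PeriodPair) (z : ℂ) :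
    Summable fun l : L.lattice ↦ (1 / (z - (l : ℂ)) + 1 / (l : ℂ) + z / (l : ℂ) ^ 2) := by
  have hs (x : ℂ) : Summable fun l : L.lattice ↦ ‖(l : ℂ) - x‖ ^ (-3 : ℤ) :=
    ZLattice.summable_norm_sub_zpow L.lattice (-3) (by simp) x
  refine Summable.of_norm_bounded_eventually (((hs 0).add (hs z)).mul_left (‖z‖ ^ 2)) ?_
  have hf : {l : L.lattice | (l : ℂ) = 0 ∨ (l : ℂ) = z}.Finite := by
    have h := ((Set.finite_singleton (0 : ℂ)).union (Set.finite_singleton z)).preimage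
      (Subtype.val_injective.injOn (s := (Subtype.val : L.lattice → ℂ) ⁻¹' _))
    exact h
  filter_upwards [hf.compl_mem_cofinite] with l hl
  simp only [Set.mem_compl_iff, Set.mem_ofPred_eq, not_or] at hl
  obtain ⟨h0, hz⟩ := hl
  have hz' : z - l ≠ 0 := sub_ne_zero.mpr (Ne.symm hz)
  have heq : 1 / (z - (l : ℂ)) + 1 / (l : ℂ) + z / (l : ℂ) ^ 2 =
      z ^ 2 * ((l : ℂ) ^ 2 * (z - l))⁻¹ := by
    field_simp
    ring
  rw [heq, norm_mul, norm_pow, norm_inv, norm_mul, norm_pow, sub_zero, norm_sub_rev z]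
  gcongr
  have ha : 0 < ‖(l : ℂ)‖ := norm_pos_iff.mpr h0
  have hb : 0 < ‖(l : ℂ) - z‖ := norm_pos_iff.mpr (sub_ne_zero.mpr hz)
  rw [show (-3 : ℤ) = -(3 : ℕ) by norm_num, zpow_neg, zpow_neg, zpow_natCast, zpow_natCast,
    mul_inv, ← inv_pow, ← inv_pow, ← inv_pow]
  have ha' := inv_pos.mpr ha
  have hb' := inv_pos.mpr hb
  generalize ‖(l : ℂ)‖⁻¹ = a at *
  generalize ‖(l : ℂ) - z‖⁻¹ = b at *
  rcases le_total a b with h | h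
  · have : a ^ 2 * b ≤ b ^ 2 * b := by gcongr
    nlinarith [pow_pos ha' 3]
  · have : a ^ 2 * b ≤ a ^ 2 * a := by gcongr
    nlinarith [pow_pos hb' 3]

variable {L : PeriodPair} {w : ℂ} {z : ℍ}

/-- If the lattice is `w (ℤ z + ℤ)`, then `2 w ζ(w / 2) = G₂(z)`. -/
theorem two_mul_weierstrassZeta_half (hw : w ≠ 0) (e : (Fin 2 → ℤ) ≃ L.lattice)
    (he : ∀ v, (e v : ℂ) = w * (v 0 * z + v 1)) :
    2 * w * L.weierstrassZeta (w / 2) = G2 z := by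
  set T : ℤ × ℤ → ℂ := fun p ↦
    1 / (1 / 2 - (p.1 * z + p.2)) + 1 / (1 / 2 + (p.1 * z + p.2)) + ((p.1 * z + p.2 : ℂ) ^ 2)⁻¹
    with hT
  have hsum := (L.summable_weierstrassZeta (w / 2)).hasSum
  -- Adding the sum over -l removes the odd term 1/l.
  have h1 := hsum.add ((Equiv.neg L.lattice).hasSum_iff.mpr hsum)
  have h2 := ((e.hasSum_iff).mpr h1).mul_left w
  have h3 : HasSum T (2 * w * L.weierstrassZeta (w / 2)) := by
    rw [← (finTwoArrowEquiv ℤ).hasSum_iff]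
    convert! h2 using 1
    · ext v
      simp only [Function.comp_apply, Equiv.neg_apply, NegMemClass.coe_neg, he, hT]
      change 1 / (1 / 2 - ((v 0 : ℂ) * z + v 1)) + 1 / (1 / 2 + ((v 0 : ℂ) * z + v 1)) +
        (((v 0 : ℂ) * z + v 1) ^ 2)⁻¹ = _
      generalize (v 0 : ℂ) * z + v 1 = x
      rw [show w / 2 - w * x = w * (1 / 2 - x) by ring,
        show w / 2 - -(w * x) = w * (1 / 2 + x) by ring]
      generalize 1 / 2 - x = A
      generalize 1 / 2 + x = B
      simp only [mul_inv, div_eq_mul_inv, mul_pow, neg_sq, inv_neg]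
      have hw' : w * w⁻¹ = 1 := mul_inv_cancel₀ hw
      linear_combination (-A⁻¹ - B⁻¹ - (x ^ 2)⁻¹ * (w * w⁻¹ + 1)) * hw'
    · rw [weierstrassZeta]
      ring
  have hrow (m : ℤ) : HasSum (fun n ↦ T (m, n)) (e2Summand m z) := by
    have hr : Summable fun n ↦ T (m, n) := h3.summable.prod_factor m
    have he2 := (e2Summand_summable m z).hasSum
    have he2' : HasSum (fun n : ℤ ↦ (((m : ℂ) * z + n) ^ 2)⁻¹) (e2Summand m z) := by
      convert! he2 using 2 with n
    -- At the half-period the two simple fractions of a row are F n and -F (n + 1), so they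
    -- telescope to 0 and only the row of G2 remains.
    set F : ℤ → ℂ := fun n ↦ 1 / ((1 / 2 - m * z) - n) with hF
    have hTF (n : ℤ) : T (m, n) = (F n - F (n + 1)) + (((m : ℂ) * z + n) ^ 2)⁻¹ := by
      simp only [hT, hF]
      congr 1
      rw [show (1 / 2 - (m : ℂ) * z - ((n + 1 : ℤ) : ℂ)) = -(1 / 2 + (m * z + n)) by
        push_cast; ring, one_div_neg_eq_neg_one_div, sub_neg_eq_add, sub_sub]
    have hFs : Summable fun n ↦ F n - F (n + 1) := by
      refine (hr.sub he2'.summable).congr fun n ↦ ?_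
      rw [hTF]
      ring
    have hF0 := hasSum_int_sub_succ_zero hFs
      (tendsto_inv_const_sub_intCast _ (by simpa using tendsto_natCast_atTop_atTop))
      (tendsto_inv_const_sub_intCast _ (by simpa using tendsto_natCast_atTop_atTop))
    have := hF0.add he2'
    rw [zero_add] at this
    exact this.congr_fun hTF
  have h4 := h3.prod_fiberwise hrow
  -- G2 sums its rows conditionally; here the row sums are summable, so the order is immaterial.
  rw [G2, tsum_eq_of_summable_unconditional h4.summable, h4.tsum_eq]

theorem G_eq_E (hw : w ≠ 0) (e : (Fin 2 → ℤ) ≃ L.lattice)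
    (he : ∀ v, (e v : ℂ) = w * (v 0 * z + v 1)) {k : ℕ} (hk : 3 ≤ k) :
    L.G k = 2 * riemannZeta k * ModularForm.E hk z / w ^ k := by
  have h := tsum_eisSummand_eq_riemannZeta_mul_eisensteinSeries hk z
  have hE : ModularForm.E hk z = (1 / 2 : ℂ) * eisensteinSeries (N := 1) 0 k z := rfl
  rw [G, ← e.tsum_eq, hE]
  simp_rw [he, mul_pow, mul_inv]
  rw [tsum_mul_left]
  have h' : ∑' v : Fin 2 → ℤ, (((v 0 : ℂ) * z + v 1) ^ k)⁻¹ =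
      riemannZeta k * eisensteinSeries (N := 1) 0 k z := by
    rw [← h]
    refine tsum_congr fun v ↦ ?_
    rw [eisSummand, zpow_neg, zpow_natCast]
  rw [h']
  field_simp

theorem g₂_eq_E₄ (hw : w ≠ 0) (e : (Fin 2 → ℤ) ≃ L.lattice)
    (he : ∀ v, (e v : ℂ) = w * (v 0 * z + v 1)) :
    L.g₂ = 4 * π ^ 4 / 3 * ModularForm.E₄ z / w ^ 4 := by
  rw [g₂, G_eq_E hw e he (k := 4) (by norm_num)]
  push_cast
  rw [riemannZeta_four]
  ring

theorem g₃_eq_E₆ (hw : w ≠ 0) (e : (Fin 2 → ℤ) ≃ L.lattice)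
    (he : ∀ v, (e v : ℂ) = w * (v 0 * z + v 1)) :
    L.g₃ = 8 * π ^ 6 / 27 * ModularForm.E₆ z / w ^ 6 := by
  have h6 : riemannZeta (6 : ℕ) = π ^ 6 / 945 := by
    have h := riemannZeta_two_mul_nat (k := 3) (by norm_num)
    have hb : bernoulli 6 = 1 / 42 := by decide +kernel
    norm_num [hb, Nat.factorial] at h ⊢
    rw [h]
    ring
  rw [g₃, G_eq_E hw e he (k := 6) (by norm_num), h6]
  ring

/-- Lattice points in the coordinates given by the two periods. -/
noncomputable def latticeEquivFinTwo (L : PeriodPair) : (Fin 2 → ℤ) ≃ L.lattice :=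
  (finTwoArrowEquiv ℤ).trans ((Equiv.prodComm ℤ ℤ).trans L.latticeEquivProd.symm.toEquiv)

theorem coe_latticeEquivFinTwo (L : PeriodPair) (v : Fin 2 → ℤ) :
    (L.latticeEquivFinTwo v : ℂ) = v 1 * L.ω₁ + v 0 * L.ω₂ :=
  L.latticeEquiv_symm_apply (v 1, v 0)

theorem coe_latticeEquivFinTwo_of_eq (h2 : L.ω₂ = L.ω₁ * z) (v : Fin 2 → ℤ) :
    (L.latticeEquivFinTwo v : ℂ) = L.ω₁ * (v 0 * z + v 1) := by
  rw [coe_latticeEquivFinTwo, h2]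
  ring

/-- Lattice points in the coordinates given by the rotated periods `ω₂, -ω₁`. -/
noncomputable def latticeEquivFinTwoRotate (L : PeriodPair) : (Fin 2 → ℤ) ≃ L.lattice :=
  (finTwoArrowEquiv ℤ).trans (((Equiv.neg ℤ).prodCongr (Equiv.refl ℤ)).trans
    L.latticeEquivProd.symm.toEquiv)

theorem coe_latticeEquivFinTwoRotate (L : PeriodPair) (v : Fin 2 → ℤ) :
    (L.latticeEquivFinTwoRotate v : ℂ) = -v 0 * L.ω₁ + v 1 * L.ω₂ := by
  refine (L.latticeEquiv_symm_apply (-v 0, v 1)).trans ?_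
  push_cast
  rfl

theorem ω₁_ne_zero (L : PeriodPair) : L.ω₁ ≠ 0 := L.indep.ne_zero 0

theorem ω₂_ne_zero (L : PeriodPair) : L.ω₂ ≠ 0 := L.indep.ne_zero 1

theorem quasiPeriod_zero_eq (h2 : L.ω₂ = L.ω₁ * z) :
    L.quasiPeriod 0 = π ^ 2 / 6 * E2 z / L.ω₁ := by
  have h := two_mul_weierstrassZeta_half L.ω₁_ne_zero _ (coe_latticeEquivFinTwo_of_eq h2)
  have hE : G2 z = π ^ 2 / 3 * E2 z := by
    have hpi : (π : ℂ) ≠ 0 := by exact_mod_cast Real.pi_ne_zero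
    simp only [E2, Pi.smul_apply, smul_eq_mul, riemannZeta_two]
    field_simp
    ring
  rw [hE] at h
  have h0 := L.ω₁_ne_zero
  simp only [quasiPeriod, halfPeriod, Matrix.cons_val_zero]
  field_simp
  linear_combination 3 * h

/-- The Legendre relation, solved for the second quasi-period. -/
theorem quasiPeriod_one_eq (h2 : L.ω₂ = L.ω₁ * z) :
    L.quasiPeriod 1 = z * L.quasiPeriod 0 - π * I / L.ω₁ := by
  have h := two_mul_weierstrassZeta_half L.ω₁_ne_zero _ (coe_latticeEquivFinTwo_of_eq h2)
  -- The basis ω₂, -ω₁ has ratio -1/z, so ζ(ω₂/2) is governed by G2(-1/z); the anomaly of G2 under S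
  -- is the constant in the Legendre relation.
  have h' := two_mul_weierstrassZeta_half (z := ModularGroup.S • z) L.ω₂_ne_zero
    L.latticeEquivFinTwoRotate fun v ↦ by
      rw [coe_latticeEquivFinTwoRotate, modular_S_smul, h2]
      have hz := ne_zero z
      simp
      field_simp
  have hS := G2_S_transform z
  have h0 := L.ω₁_ne_zero
  have hz := ne_zero z
  rw [← h, ← h', h2] at hS
  simp only [quasiPeriod, halfPeriod, Matrix.cons_val_zero, Matrix.cons_val_one, h2]
  field_simp at hS ⊢
  linear_combination -hS

end PeriodPair

end LatticeSums

/-! ### Eisenstein series on the imaginary axis -/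

section ImaginaryAxis

open UpperHalfPlane hiding I
open Complex EisensteinSeries Filter Topology Function MatrixGroups Derivative ModularForm Manifold
open scoped Real

/-- The point `i t` of the upper half plane (for `t > 0`). -/
noncomputable def axisPoint (t : ℝ) : ℍ := ofComplex (I * t)

theorem coe_axisPoint {t : ℝ} (ht : 0 < t) : (axisPoint t : ℂ) = I * t :=
  congrArg UpperHalfPlane.coe (ofComplex_apply_of_im_pos (z := I * t) (by simpa using ht))

/-- The real part of a function along the imaginary axis. -/
noncomputable def axisRe (f : ℍ → ℂ) (t : ℝ) : ℝ := (f (axisPoint t)).re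

theorem tendsto_axisPoint : Tendsto axisPoint atTop atImInfty := by
  refine tendsto_comap_im_ofComplex.comp (tendsto_comap_iff.mpr ?_)
  refine tendsto_id.congr fun t ↦ ?_
  simp

theorem tendsto_axisRe {f : ℍ → ℂ} {a : ℝ} (h : Tendsto f atImInfty (𝓝 a)) :
    Tendsto (axisRe f) atTop (𝓝 a) :=
  (Complex.continuous_re.tendsto _).comp (h.comp tendsto_axisPoint)

theorem hasDerivAt_axisRe {f : ℍ → ℂ} (hf : MDiff f) {t : ℝ} (ht : 0 < t) :
    HasDerivAt (axisRe f) (-2 * π * axisRe (normalizedDerivOfComplex f) t) t := by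
  have h1 := (UpperHalfPlane.mdifferentiableAt_iff.mp (hf (axisPoint t))).hasDerivAt
  rw [coe_axisPoint ht] at h1
  have h2 : HasDerivAt (fun s : ℝ ↦ I * (s : ℂ)) (I * 1) t :=
    (Complex.ofRealCLM.hasDerivAt (x := t)).const_mul I
  have h3 := (Complex.reCLM.hasFDerivAt).comp_hasDerivAt t (h1.comp t h2)
  refine h3.congr_deriv ?_
  have hpi : (π : ℂ) ≠ 0 := by exact_mod_cast Real.pi_ne_zero
  have : deriv (f ∘ ofComplex) (I * t) = (2 * π * I) * normalizedDerivOfComplex f (axisPoint t) := by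
    rw [normalizedDerivOfComplex, coe_axisPoint ht, mul_inv_cancel_left₀]
    simp [hpi]
  rw [this, show (2 * π * I) * normalizedDerivOfComplex f (axisPoint t) * (I * 1) =
    ((-2 * π : ℝ) : ℂ) * normalizedDerivOfComplex f (axisPoint t) * (-I ^ 2) by push_cast; ring,
    Complex.I_sq, neg_neg, mul_one, Complex.reCLM_apply, Complex.re_ofReal_mul]
  rfl

theorem qParam_axisPoint {t : ℝ} (ht : 0 < t) :
    Periodic.qParam 1 (axisPoint t) = (Real.exp (-(2 * π * t)) : ℝ) := by
  rw [Periodic.qParam, coe_axisPoint ht, Complex.ofReal_exp]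
  congr 1
  push_cast
  linear_combination (2 * π * t) * Complex.I_sq

/-- On the axis q is real, so real coefficients give real values. -/
theorem hasSum_axisRe {f : ℍ → ℂ} {c : ℕ → ℝ}
    (hf : ∀ τ : ℍ, HasSum (fun m ↦ (c m : ℂ) * Periodic.qParam 1 τ ^ m) (f τ)) {t : ℝ}
    (ht : 0 < t) : HasSum (fun m ↦ c m * Real.exp (-(2 * π * t)) ^ m) (axisRe f t) ∧
      f (axisPoint t) = axisRe f t := by
  have h := hf (axisPoint t)
  rw [qParam_axisPoint ht] at h
  have hre := Complex.reCLM.hasSum h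
  have him := Complex.imCLM.hasSum h
  simp only [← Complex.ofReal_pow, ← Complex.ofReal_mul, Complex.reCLM_apply, Complex.ofReal_re,
    Complex.imCLM_apply, Complex.ofReal_im] at hre him
  refine ⟨hre, Complex.ext rfl ?_⟩
  rw [Complex.ofReal_im]
  exact him.unique hasSum_zero

theorem E2_axisPoint {t : ℝ} (ht : 0 < t) : E2 (axisPoint t) = axisRe E2 t :=
  (hasSum_axisRe (c := fun m ↦ if m = 0 then 1 else -24 * ArithmeticFunction.sigma 1 m)
    (fun τ ↦ by
      have h := hasSum_qExpansion_E2 τ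
      simp only [Periodic.qParam, ofReal_one, div_one, smul_eq_mul] at h ⊢
      convert! h using 3 with m
      split_ifs <;> simp) ht).2

theorem hasSum_axisRe_E {k : ℕ} (hk : 3 ≤ k) (hk2 : Even k) {t : ℝ} (ht : 0 < t) :
    HasSum (fun m : ℕ ↦ (if m = 0 then 1 else -(2 * k / bernoulli k : ℝ) *
      ArithmeticFunction.sigma (k - 1) m) * Real.exp (-(2 * π * t)) ^ m)
      (axisRe (ModularForm.E hk) t) ∧
      ModularForm.E hk (axisPoint t) = axisRe (ModularForm.E hk) t :=
  hasSum_axisRe (fun τ ↦ by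
    have h := ModularForm.hasSum_qExpansion (ModularForm.E hk) one_pos one_mem_strictPeriods_SL τ
    convert! h using 3 with m
    rw [E_qExpansion_coeff hk hk2]
    split_ifs <;> simp) ht

/-- Since -8/B₄ = 240, all q-coefficients are nonnegative, with constant term 1. -/
theorem axisRe_E₄_pos {t : ℝ} (ht : 0 < t) : 0 < axisRe E₄ t := by
  have h := (hasSum_axisRe_E (k := 4) (by norm_num) (by decide) ht).1
  refine lt_of_lt_of_le one_pos ((sum_le_hasSum {0} (fun m _ ↦ ?_) h).trans' ?_)
  · rw [show bernoulli 4 = -1 / 30 by decide +kernel]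
    split_ifs
    · positivity
    · push_cast
      norm_num
      positivity
  · simp

theorem S_smul_axisPoint {t : ℝ} (ht : 0 < t) :
    ModularGroup.S • axisPoint t = axisPoint t⁻¹ := by
  rw [modular_S_smul]
  ext
  simp [coe_axisPoint ht, coe_axisPoint (inv_pos.mpr ht), mul_comm]

theorem E_axisPoint_inv {k : ℕ} (hk : 3 ≤ k) {t : ℝ} (ht : 0 < t) :
    ModularForm.E hk (axisPoint t⁻¹) = (I * t) ^ k * ModularForm.E hk (axisPoint t) := by
  have h := congrFun (E_slash hk ModularGroup.S) (axisPoint t)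
  rw [ModularForm.SL_slash_apply, ModularGroup.denom_S, S_smul_axisPoint ht, coe_axisPoint ht,
    zpow_neg, zpow_natCast] at h
  have h0 : (I * t) ^ k ≠ 0 := pow_ne_zero _ (by simp [ht.ne'])
  rw [← h]
  field_simp

theorem axisRe_E₄_inv {t : ℝ} (ht : 0 < t) : axisRe E₄ t⁻¹ = t ^ 4 * axisRe E₄ t := by
  rw [axisRe, E_axisPoint_inv _ ht, mul_pow, Complex.I_pow_four, one_mul, ← Complex.ofReal_pow,
    Complex.re_ofReal_mul, axisRe]

theorem axisRe_E₆_inv {t : ℝ} (ht : 0 < t) : axisRe E₆ t⁻¹ = -(t ^ 6 * axisRe E₆ t) := by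
  rw [axisRe, E_axisPoint_inv _ ht, mul_pow, show I ^ 6 = -1 by
    rw [show 6 = 4 + 2 from rfl, pow_add, Complex.I_pow_four, Complex.I_sq, one_mul],
    neg_one_mul, neg_mul, Complex.neg_re, ← Complex.ofReal_pow, Complex.re_ofReal_mul, axisRe]

theorem E₄_axisPoint {t : ℝ} (ht : 0 < t) : E₄ (axisPoint t) = axisRe E₄ t :=
  (hasSum_axisRe_E (k := 4) (by norm_num) (by decide) ht).2

theorem E₆_axisPoint {t : ℝ} (ht : 0 < t) : E₆ (axisPoint t) = axisRe E₆ t :=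
  (hasSum_axisRe_E (k := 6) (by norm_num) (by decide) ht).2

theorem hasDerivAt_axisRe_E2 {t : ℝ} (ht : 0 < t) :
    HasDerivAt (axisRe E2) (-(π / 6) * (axisRe E2 t ^ 2 - axisRe E₄ t)) t := by
  refine (hasDerivAt_axisRe E2_mdifferentiable ht).congr_deriv ?_
  have h : axisRe (normalizedDerivOfComplex E2) t = (axisRe E2 t ^ 2 - axisRe E₄ t) / 12 := by
    rw [axisRe, normalizedDerivOfComplex_E2, E2_axisPoint ht, E₄_axisPoint ht]
    exact_mod_cast Complex.ofReal_re _
  rw [h]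
  ring

theorem hasDerivAt_axisRe_E₄ {t : ℝ} (ht : 0 < t) :
    HasDerivAt (axisRe E₄) (-(2 * π / 3) * (axisRe E2 t * axisRe E₄ t - axisRe E₆ t)) t := by
  refine (hasDerivAt_axisRe (E_mdifferentiable _) ht).congr_deriv ?_
  have h : axisRe (normalizedDerivOfComplex E₄) t =
      (axisRe E2 t * axisRe E₄ t - axisRe E₆ t) / 3 := by
    rw [axisRe, normalizedDerivOfComplex_E₄, E2_axisPoint ht, E₄_axisPoint ht, E₆_axisPoint ht]
    exact_mod_cast Complex.ofReal_re _
  rw [h]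
  ring

theorem hasDerivAt_axisRe_E₆ {t : ℝ} (ht : 0 < t) :
    HasDerivAt (axisRe E₆) (-π * (axisRe E2 t * axisRe E₆ t - axisRe E₄ t ^ 2)) t := by
  refine (hasDerivAt_axisRe (E_mdifferentiable _) ht).congr_deriv ?_
  have h : axisRe (normalizedDerivOfComplex E₆) t =
      (axisRe E2 t * axisRe E₆ t - axisRe E₄ t ^ 2) / 2 := by
    rw [axisRe, normalizedDerivOfComplex_E₆, E2_axisPoint ht, E₄_axisPoint ht, E₆_axisPoint ht]
    exact_mod_cast Complex.ofReal_re _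
  rw [h]
  ring

/-- The discriminant has no zero, so its sign is constant on the axis; at t = 1 the symmetry t ↦ 1/t
forces E₆ = 0 while E₄ > 0. -/
theorem axisRe_discriminant_pos {t : ℝ} (ht : 0 < t) :
    0 < axisRe E₄ t ^ 3 - axisRe E₆ t ^ 2 := by
  have hne : ∀ s ∈ Set.Ioi (0 : ℝ), axisRe E₄ s ^ 3 - axisRe E₆ s ^ 2 ≠ 0 := by
    intro s hs h0
    have h := discriminant_eq_E₄_cube_sub_E₆_sq (axisPoint s)
    rw [E₄_axisPoint hs, E₆_axisPoint hs] at h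
    refine discriminant_ne_zero (axisPoint s) ?_
    rw [h]
    exact_mod_cast by rw [h0, zero_div]
  have hc : ContinuousOn (fun s ↦ axisRe E₄ s ^ 3 - axisRe E₆ s ^ 2) (Set.Ioi 0) := fun s hs ↦
    (((hasDerivAt_axisRe_E₄ hs).continuousAt.pow 3).sub
      ((hasDerivAt_axisRe_E₆ hs).continuousAt.pow 2)).continuousWithinAt
  have h1 : 0 < axisRe E₄ 1 ^ 3 - axisRe E₆ 1 ^ 2 := by
    have h := axisRe_E₆_inv one_pos
    rw [inv_one] at h
    have h6 : axisRe E₆ 1 = 0 := by linarith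
    rw [h6]
    have := pow_pos (axisRe_E₄_pos one_pos) 3
    simpa using this
  by_contra hneg
  obtain ⟨s, hs, hs0⟩ := isPreconnected_Ioi.intermediate_value (a := t) (b := 1) ht
    (Set.mem_Ioi.mpr one_pos) hc ⟨not_lt.mp hneg, h1.le⟩
  exact hne s hs hs0

/-- The real invariant `E₆ / E₄ ^ (3 / 2)` on the imaginary axis. -/
noncomputable def axisInvariant (t : ℝ) : ℝ := axisRe E₆ t / (axisRe E₄ t * √(axisRe E₄ t))

/-- The quotient has weight 0, so the E2 terms of Ramanujan's formulas cancel. -/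
theorem hasDerivAt_axisInvariant {t : ℝ} (ht : 0 < t) :
    HasDerivAt axisInvariant (π * (axisRe E₄ t ^ 3 - axisRe E₆ t ^ 2) /
      (axisRe E₄ t ^ 2 * √(axisRe E₄ t))) t := by
  have hQ := axisRe_E₄_pos ht
  have hs := Real.sqrt_pos.mpr hQ
  have h := (hasDerivAt_axisRe_E₆ ht).div ((hasDerivAt_axisRe_E₄ ht).mul
    ((hasDerivAt_axisRe_E₄ ht).sqrt hQ.ne')) (mul_pos hQ hs).ne'
  refine h.congr_deriv ?_
  simp only [Pi.mul_apply]
  have hsq := Real.sq_sqrt hQ.le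
  generalize √(axisRe E₄ t) = s at *
  rw [← hsq]
  field_simp
  ring

theorem strictMonoOn_axisInvariant : StrictMonoOn axisInvariant (Set.Ioi 0) := by
  refine strictMonoOn_of_deriv_pos (convex_Ioi 0) (fun t ht ↦
    (hasDerivAt_axisInvariant ht).continuousAt.continuousWithinAt) fun t ht ↦ ?_
  rw [interior_Ioi] at ht
  rw [(hasDerivAt_axisInvariant ht).deriv]
  have := axisRe_discriminant_pos ht
  have := axisRe_E₄_pos ht
  have := Real.pi_pos
  positivity

theorem hasStrictDerivAt_axisInvariant {t : ℝ} (ht : 0 < t) :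
    HasStrictDerivAt axisInvariant (π * (axisRe E₄ t ^ 3 - axisRe E₆ t ^ 2) /
      (axisRe E₄ t ^ 2 * √(axisRe E₄ t))) t := by
  refine hasStrictDerivAt_of_hasDerivAt_of_continuousAt (f' := fun t ↦
    π * (axisRe E₄ t ^ 3 - axisRe E₆ t ^ 2) / (axisRe E₄ t ^ 2 * √(axisRe E₄ t))) ?_ ?_
  · filter_upwards [lt_mem_nhds ht] with s hs using hasDerivAt_axisInvariant hs
  · have h4 := (hasDerivAt_axisRe_E₄ ht).continuousAt
    have h6 := (hasDerivAt_axisRe_E₆ ht).continuousAt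
    have hQ := axisRe_E₄_pos ht
    refine ContinuousAt.div (by fun_prop) (by fun_prop) ?_
    have := Real.sqrt_pos.mpr hQ
    positivity

theorem axisInvariant_inv {t : ℝ} (ht : 0 < t) : axisInvariant t⁻¹ = -axisInvariant t := by
  have hQ := axisRe_E₄_pos ht
  have hs := Real.sqrt_pos.mpr hQ
  rw [axisInvariant, axisInvariant, axisRe_E₄_inv ht, axisRe_E₆_inv ht,
    Real.sqrt_mul (by positivity), show t ^ 4 = (t ^ 2) ^ 2 by ring, Real.sqrt_sq (by positivity)]
  field_simp

theorem tendsto_axisInvariant_atTop : Tendsto axisInvariant atTop (𝓝 1) := by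
  have h4 : Tendsto (axisRe E₄) atTop (𝓝 1) := tendsto_axisRe (a := 1) (by
    simpa using tendsto_E_atImInfty (k := 4) (by norm_num) (by decide))
  have h6 : Tendsto (axisRe E₆) atTop (𝓝 1) := tendsto_axisRe (a := 1) (by
    simpa using tendsto_E_atImInfty (k := 6) (by norm_num) (by decide))
  have h := h6.div (h4.mul (h4.sqrt)) (by simp)
  simpa using! h

/-- The limit 1 at infinity becomes -1 at 0 by the oddness under t ↦ 1/t. -/
theorem exists_axisInvariant_eq {v : ℝ} (hv : v ∈ Set.Ioo (-1 : ℝ) 1) :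
    ∃ t, 0 < t ∧ axisInvariant t = v := by
  have h0 : Tendsto axisInvariant (𝓝[>] 0) (𝓝 (-1)) := by
    have h := (tendsto_axisInvariant_atTop.comp tendsto_inv_nhdsGT_zero).neg
    refine h.congr' ?_
    filter_upwards [self_mem_nhdsWithin] with t ht
    rw [Function.comp_apply, axisInvariant_inv ht, neg_neg]
  obtain ⟨t, ht, h⟩ := isPreconnected_Ioi.intermediate_value_Ioo (l₁ := 𝓝[>] (0 : ℝ))
    (l₂ := atTop) inf_le_right (le_principal_iff.mpr (Ioi_mem_atTop 0))
    (fun t ht ↦ (hasDerivAt_axisInvariant ht).continuousAt.continuousWithinAt) h0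
    tendsto_axisInvariant_atTop hv
  exact ⟨t, ht, h⟩

end ImaginaryAxis

/-! ### Solving for the periods and differentiating in c -/

section RectangularLattices

open UpperHalfPlane hiding I
open Complex EisensteinSeries Filter Topology ModularForm
open scoped Real

/-- The value of `E₆ / E₄ ^ (3 / 2)` prescribed by the invariants `g₂, g₃`. -/
noncomputable def invariantOfParam (c : ℝ) : ℝ :=
  3 * √3 * (c / 6 - 1 / 216 - c ^ 2) / ((1 / 12 - 2 * c) * √(1 / 12 - 2 * c))

theorem g₂_param_pos {c : ℝ} (hc : c ∈ Set.Ioo (0 : ℝ) (1 / 27)) : 0 < 1 / 12 - 2 * c := by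
  linarith [hc.2]

/-- Used with a = w²: once the g₂ equation holds, the g₃ equation is a condition on t alone. -/
theorem axisInvariant_eq_iff {t a g h : ℝ} (ht : 0 < t) (ha : 0 < a) (hg : 0 < g)
    (h₂ : 4 * π ^ 4 / 3 * axisRe E₄ t = g * a ^ 2) :
    axisInvariant t = 3 * √3 * h / (g * √g) ↔ 8 * π ^ 6 / 27 * axisRe E₆ t = h * a ^ 3 := by
  have hQ := axisRe_E₄_pos ht
  rw [axisInvariant]
  have hQs := Real.sq_sqrt hQ.le
  have hgs := Real.sq_sqrt hg.le
  have h3s := Real.sq_sqrt (show (0 : ℝ) ≤ 3 by norm_num)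
  have hQp := Real.sqrt_pos.mpr hQ
  have hgp := Real.sqrt_pos.mpr hg
  have h3p := Real.sqrt_pos.mpr (show (0 : ℝ) < 3 by norm_num)
  have hpi := Real.pi_pos
  generalize √(axisRe E₄ t) = s at *
  generalize √g = r at *
  generalize √3 = q at *
  generalize axisRe E₆ t = R at *
  rw [← hQs] at h₂ ⊢
  rw [← hgs] at h₂ ⊢
  -- The positive square root of the g₂ equation; its cube links the two denominators.
  have hs : 2 * π ^ 2 * s = q * a * r := by
    have h4 : (2 * π ^ 2 * s) ^ 2 = (q * a * r) ^ 2 := by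
      linear_combination 3 * h₂ - a ^ 2 * r ^ 2 * h3s
    exact (sq_eq_sq₀ (by positivity) (by positivity)).mp h4
  have hs3 : 8 * π ^ 6 * s ^ 3 = 3 * q * a ^ 3 * r ^ 3 := by
    have : (2 * π ^ 2 * s) ^ 3 = (q * a * r) ^ 3 := by rw [hs]
    linear_combination this + q * a ^ 3 * r ^ 3 * h3s
  rw [div_eq_div_iff (by positivity) (by positivity)]
  constructor
  · intro H
    have hr : r ^ 3 ≠ 0 := by positivity
    refine mul_right_cancel₀ hr ?_
    linear_combination 8 * π ^ 6 / 27 * H + q * h / 9 * hs3 + h * a ^ 3 * r ^ 3 / 3 * h3s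
  · intro H
    have hr : 8 * π ^ 6 ≠ 0 := by positivity
    refine mul_left_cancel₀ hr ?_
    linear_combination 27 * r ^ 3 * H - 3 * q * h * hs3 - 9 * h * a ^ 3 * r ^ 3 * h3s

theorem invariantOfParam_mem {c : ℝ} (hc : c ∈ Set.Ioo (0 : ℝ) (1 / 27)) :
    invariantOfParam c ∈ Set.Ioo (-1 : ℝ) 1 := by
  have hg := g₂_param_pos hc
  have hgp := Real.sqrt_pos.mpr hg
  have hgs := Real.sq_sqrt hg.le
  rw [Set.mem_Ioo, ← abs_lt, ← sq_lt_one_iff_abs_lt_one, invariantOfParam, div_pow,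
    div_lt_one (by positivity), mul_pow, mul_pow, mul_pow, hgs, Real.sq_sqrt (by norm_num)]
  -- This is g₂³ - 27g₃².
  have : 0 < c ^ 3 * (1 - 27 * c) := mul_pos (pow_pos hc.1 3) (by linarith [hc.2])
  nlinarith

theorem differentiableAt_invariantOfParam {c : ℝ} (hc : c ∈ Set.Ioo (0 : ℝ) (1 / 27)) :
    DifferentiableAt ℝ invariantOfParam c := by
  have hg := g₂_param_pos hc
  have hgp := Real.sqrt_pos.mpr hg
  have hs : DifferentiableAt ℝ (fun c : ℝ ↦ √(1 / 12 - 2 * c)) c :=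
    DifferentiableAt.sqrt (by fun_prop) hg.ne'
  refine DifferentiableAt.div (by fun_prop) (DifferentiableAt.mul (by fun_prop) hs) ?_
  positivity

/-- The equations satisfied by the period `w` and the ratio `t` of a rectangular lattice with
periods `w, i t w` and the invariants of parameter `c`. -/
structure IsPeriodRatio (w t c : ℝ) : Prop where
  pos : 0 < w
  ratio_pos : 0 < t
  g₂_eq : 4 * π ^ 4 / 3 * axisRe E₄ t = (1 / 12 - 2 * c) * w ^ 4
  g₃_eq : 8 * π ^ 6 / 27 * axisRe E₆ t = (c / 6 - 1 / 216 - c ^ 2) * w ^ 6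

/-- The first quasi-period of the lattice with periods `w, i t w`. -/
noncomputable def realQuasiPeriod (w t : ℝ) : ℝ := π ^ 2 / 6 * axisRe E2 t / w

/-- The second quasi-period, divided by `i`, of the lattice with periods `w, i t w`. -/
noncomputable def imagQuasiPeriod (w t : ℝ) : ℝ := t * realQuasiPeriod w t - π / w

namespace IsPeriodRatio

theorem axisInvariant_eq {w t c : ℝ} (hc : c ∈ Set.Ioo (0 : ℝ) (1 / 27))
    (h : IsPeriodRatio w t c) : axisInvariant t = invariantOfParam c :=
  (axisInvariant_eq_iff h.ratio_pos (pow_pos h.pos 2) (g₂_param_pos hc)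
    (by rw [h.g₂_eq]; ring)).mpr (by rw [h.g₃_eq]; ring)

theorem exists_of_mem {c : ℝ} (hc : c ∈ Set.Ioo (0 : ℝ) (1 / 27)) :
    ∃ w t, IsPeriodRatio w t c := by
  obtain ⟨t, ht, h⟩ := exists_axisInvariant_eq (invariantOfParam_mem hc)
  have hg := g₂_param_pos hc
  have hQ := axisRe_E₄_pos ht
  have hx : 0 < 4 * π ^ 4 / 3 * axisRe E₄ t / (1 / 12 - 2 * c) := by
    have := Real.pi_pos
    positivity
  set x := 4 * π ^ 4 / 3 * axisRe E₄ t / (1 / 12 - 2 * c) with hxd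
  have hx2 : √(√x) ^ 2 = √x := Real.sq_sqrt (Real.sqrt_nonneg _)
  have h2 : 4 * π ^ 4 / 3 * axisRe E₄ t = (1 / 12 - 2 * c) * √x ^ 2 := by
    rw [Real.sq_sqrt hx.le, hxd, mul_div_cancel₀ _ hg.ne']
  refine ⟨√(√x), t, Real.sqrt_pos.mpr (Real.sqrt_pos.mpr hx), ht, ?_, ?_⟩
  · rw [h2, show 4 = 2 * 2 from rfl, pow_mul, hx2]
  · rw [(axisInvariant_eq_iff ht (Real.sqrt_pos.mpr hx) hg h2).mp h,
      show 6 = 2 * 3 from rfl, pow_mul, hx2]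

theorem unique {w t w' t' c : ℝ} (hc : c ∈ Set.Ioo (0 : ℝ) (1 / 27))
    (h : IsPeriodRatio w t c) (h' : IsPeriodRatio w' t' c) : w = w' ∧ t = t' := by
  have ht : t = t' := strictMonoOn_axisInvariant.injOn h.ratio_pos h'.ratio_pos
    ((h.axisInvariant_eq hc).trans (h'.axisInvariant_eq hc).symm)
  subst ht
  refine ⟨?_, rfl⟩
  have h4 := mul_left_cancel₀ (g₂_param_pos hc).ne' (h.g₂_eq.symm.trans h'.g₂_eq)
  exact (pow_left_inj₀ h.pos.le h'.pos.le (by norm_num)).mp h4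

variable {w t : ℝ → ℝ} {c : ℝ}

/-- No regularity of t is assumed: injectivity of `axisInvariant` identifies t near c with its local
inverse applied to `invariantOfParam`. -/
theorem differentiableAt_ratio (h : ∀ c ∈ Set.Ioo (0 : ℝ) (1 / 27), IsPeriodRatio (w c) (t c) c)
    (hc : c ∈ Set.Ioo (0 : ℝ) (1 / 27)) : DifferentiableAt ℝ t c := by
  have ht := (h c hc).ratio_pos
  have hs := hasStrictDerivAt_axisInvariant ht
  have hne : π * (axisRe E₄ (t c) ^ 3 - axisRe E₆ (t c) ^ 2) /
      (axisRe E₄ (t c) ^ 2 * √(axisRe E₄ (t c))) ≠ 0 := by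
    have := axisRe_discriminant_pos ht
    have := axisRe_E₄_pos ht
    have := Real.pi_pos
    positivity
  set g := hs.localInverse _ _ _ hne with hg
  have hv := (h c hc).axisInvariant_eq hc
  have hinv := hs.to_localInverse hne
  have hgc : g (axisInvariant (t c)) = t c :=
    (hs.hasStrictFDerivAt_equiv hne).localInverse_apply_image
  have hright := hs.eventually_right_inverse hne
  have hdv := differentiableAt_invariantOfParam hc
  rw [hv] at hinv hright hgc
  have hcomp : DifferentiableAt ℝ (fun x ↦ g (invariantOfParam x)) c :=
    DifferentiableAt.comp (g := g) c hinv.hasDerivAt.differentiableAt hdv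
  refine hcomp.congr_of_eventuallyEq ?_
  have hpos : ∀ᶠ x in 𝓝 c, 0 < g (invariantOfParam x) :=
    hcomp.continuousAt.eventually (lt_mem_nhds (ht.trans_eq hgc.symm))
  filter_upwards [hpos, hdv.continuousAt.eventually hright, Ioo_mem_nhds hc.1 hc.2]
    with x hx hx' hxc
  exact strictMonoOn_axisInvariant.injOn (h x hxc).ratio_pos hx
    (((h x hxc).axisInvariant_eq hxc).trans hx'.symm)

theorem differentiableAt_period (h : ∀ c ∈ Set.Ioo (0 : ℝ) (1 / 27), IsPeriodRatio (w c) (t c) c)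
    (hc : c ∈ Set.Ioo (0 : ℝ) (1 / 27)) : DifferentiableAt ℝ w c := by
  have ht := (h c hc).ratio_pos
  have hg := g₂_param_pos hc
  have hQ := axisRe_E₄_pos ht
  have hpi := Real.pi_pos
  have hd : DifferentiableAt ℝ
      (fun x ↦ √(√(4 * π ^ 4 / 3 * axisRe E₄ (t x) / (1 / 12 - 2 * x)))) c := by
    have h1 : DifferentiableAt ℝ (fun x ↦ axisRe E₄ (t x)) c :=
      DifferentiableAt.comp (g := axisRe E₄) c (hasDerivAt_axisRe_E₄ ht).differentiableAt
        (differentiableAt_ratio h hc)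
    refine DifferentiableAt.sqrt (DifferentiableAt.sqrt (DifferentiableAt.div
      (h1.const_mul _) (by fun_prop) hg.ne') ?_) ?_
    · positivity
    · exact (Real.sqrt_pos.mpr (by positivity)).ne'
  refine hd.congr_of_eventuallyEq ?_
  filter_upwards [Ioo_mem_nhds hc.1 hc.2] with x hx
  rw [(h x hx).g₂_eq, mul_div_cancel_left₀ _ (g₂_param_pos hx).ne',
    show w x ^ 4 = (w x ^ 2) ^ 2 by ring, Real.sqrt_sq (by positivity),
    Real.sqrt_sq (h x hx).pos.le]

theorem hasDerivAt (h : ∀ c ∈ Set.Ioo (0 : ℝ) (1 / 27), IsPeriodRatio (w c) (t c) c)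
    (hc : c ∈ Set.Ioo (0 : ℝ) (1 / 27)) :
    HasDerivAt t (6 * π / (w c ^ 2 * (c * (1 - 27 * c)))) c ∧
    HasDerivAt w (-(π ^ 2 * axisRe E2 (t c) / w c + 3 * w c * (1 / 12 - 3 * c)) /
      (c * (1 - 27 * c))) c := by
  have ht := (differentiableAt_ratio h hc).hasDerivAt
  have hw := (differentiableAt_period h hc).hasDerivAt
  have htp := (h c hc).ratio_pos
  have hwp := (h c hc).pos
  have e2 := (h c hc).g₂_eq
  have e3 := (h c hc).g₃_eq
  have hg := g₂_param_pos hc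
  have hpi := Real.pi_pos
  have hc0 := hc.1
  have hc1 : 0 < 1 - 27 * c := by linarith [hc.2]
  have hc2 : 1 - c * 27 ≠ 0 := by linarith
  have hev := Ioo_mem_nhds hc.1 hc.2
  have d2 : 4 * π ^ 4 / 3 * (-(2 * π / 3) *
      (axisRe E2 (t c) * axisRe E₄ (t c) - axisRe E₆ (t c)) * deriv t c) =
      -2 * w c ^ 4 + (1 / 12 - 2 * c) * (4 * w c ^ 3 * deriv w c) := by
    have l := ((hasDerivAt_axisRe_E₄ htp).comp c ht).const_mul (4 * π ^ 4 / 3)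
    have r := (((hasDerivAt_id c).const_mul 2).const_sub (1 / 12)).mul (hw.pow 4)
    have l' := l.congr_of_eventuallyEq (f₁ := (fun x : ℝ ↦ 1 / 12 - 2 * id x) * w ^ 4) (by
      filter_upwards [hev] with x hx using (h x hx).g₂_eq.symm)
    have := l'.unique r
    simp at this
    linear_combination this
  have d3 : 8 * π ^ 6 / 27 * (-π *
      (axisRe E2 (t c) * axisRe E₆ (t c) - axisRe E₄ (t c) ^ 2) * deriv t c) =
      (1 / 6 - 2 * c) * w c ^ 6 +
        (c / 6 - 1 / 216 - c ^ 2) * (6 * w c ^ 5 * deriv w c) := by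
    have l := ((hasDerivAt_axisRe_E₆ htp).comp c ht).const_mul (8 * π ^ 6 / 27)
    have r := ((((hasDerivAt_id c).div_const 6).sub_const (1 / 216)).sub
      ((hasDerivAt_id c).pow 2)).mul (hw.pow 6)
    have l' := l.congr_of_eventuallyEq
      (f₁ := ((fun x : ℝ ↦ id x / 6 - 1 / 216) - id ^ 2) * w ^ 6) (by
      filter_upwards [hev] with x hx using (h x hx).g₃_eq.symm)
    have := l'.unique r
    simp at this
    linear_combination this
  have hQ : axisRe E₄ (t c) = 3 * ((1 / 12 - 2 * c) * w c ^ 4) / (4 * π ^ 4) := by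
    rw [← e2]; field_simp
  have hR : axisRe E₆ (t c) = 27 * ((c / 6 - 1 / 216 - c ^ 2) * w c ^ 6) / (8 * π ^ 6) := by
    rw [← e3]; field_simp
  rw [hQ, hR] at d2 d3
  generalize axisRe E2 (t c) = P at *
  generalize hT : deriv t c = T at *
  generalize hW : deriv w c = W at *
  generalize w c = a at *
  have kT : T = 6 * π / (a ^ 2 * (c * (1 - 27 * c))) := by
    field_simp at d2 d3 ⊢
    -- The weights 1 - 24c = 12g₂ and 1296g₃ eliminate W and P together. The coefficient of T then
    -- carries g₂³ - 27g₃² = c³(1 - 27c) and the other side 2g₂g₃′ - 3g₃g₂′ = 2c², hence the common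
    -- factor c².
    refine mul_left_cancel₀ (show a * c ^ 2 ≠ 0 by positivity) ?_
    linear_combination ((1 - 24 * c) * d3 - (216 * c - 6 - 1296 * c ^ 2) * d2) / 161243136
  have kW : W = -(π ^ 2 * P / a + 3 * a * (1 / 12 - 3 * c)) / (c * (1 - 27 * c)) := by
    rw [kT] at d2
    field_simp at d2 ⊢
    refine mul_left_cancel₀ (show 1 - 24 * c ≠ 0 by linarith) ?_
    linear_combination -d2 / 5184
  exact ⟨kT ▸ ht, kW ▸ hw⟩

theorem hasDerivAt_realQuasiPeriod
    (h : ∀ c ∈ Set.Ioo (0 : ℝ) (1 / 27), IsPeriodRatio (w c) (t c) c)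
    (hc : c ∈ Set.Ioo (0 : ℝ) (1 / 27)) :
    HasDerivAt (fun x ↦ realQuasiPeriod (w x) (t x))
      (1 / (c * (1 - 27 * c)) * (1 / 4 * (1 - 36 * c) * realQuasiPeriod (w c) (t c) +
        1 / 48 * (1 - 24 * c) * (w c / 2))) c := by
  obtain ⟨ht, hw⟩ := IsPeriodRatio.hasDerivAt h hc
  have htp := (h c hc).ratio_pos
  have hwp := (h c hc).pos
  have e2 := (h c hc).g₂_eq
  have hpi := Real.pi_pos
  have hc0 := hc.1
  have hc1 : 0 < 1 - 27 * c := by linarith [hc.2]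
  have hc2 : 1 - c * 27 ≠ 0 := by linarith
  refine ((((hasDerivAt_axisRe_E2 htp).comp c ht).const_mul (π ^ 2 / 6)).div hw
    hwp.ne').congr_deriv ?_
  have hQ : axisRe E₄ (t c) = 3 * ((1 / 12 - 2 * c) * w c ^ 4) / (4 * π ^ 4) := by
    rw [← e2]; field_simp
  simp only [realQuasiPeriod, Function.comp_apply]
  rw [hQ]
  field_simp
  ring

/-- The E2 terms of t′η₁ and of the derivative of -π/w cancel; what is left is the diagonal
coefficient times -π/w. -/
theorem hasDerivAt_imagQuasiPeriod
    (h : ∀ c ∈ Set.Ioo (0 : ℝ) (1 / 27), IsPeriodRatio (w c) (t c) c)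
    (hc : c ∈ Set.Ioo (0 : ℝ) (1 / 27)) :
    HasDerivAt (fun x ↦ imagQuasiPeriod (w x) (t x))
      (1 / (c * (1 - 27 * c)) * (1 / 4 * (1 - 36 * c) * imagQuasiPeriod (w c) (t c) +
        1 / 48 * (1 - 24 * c) * (t c * w c / 2))) c := by
  obtain ⟨ht, hw⟩ := IsPeriodRatio.hasDerivAt h hc
  have he := hasDerivAt_realQuasiPeriod h hc
  have hwp := (h c hc).pos
  have hpi := Real.pi_pos
  have hc0 := hc.1
  have hc1 : 0 < 1 - 27 * c := by linarith [hc.2]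
  have hc2 : 1 - c * 27 ≠ 0 := by linarith
  refine ((ht.mul he).sub ((hasDerivAt_const c π).div hw hwp.ne')).congr_deriv ?_
  simp only [imagQuasiPeriod, realQuasiPeriod]
  field_simp
  ring

theorem hasDerivAt_realHalfPeriod
    (h : ∀ c ∈ Set.Ioo (0 : ℝ) (1 / 27), IsPeriodRatio (w c) (t c) c)
    (hc : c ∈ Set.Ioo (0 : ℝ) (1 / 27)) :
    HasDerivAt (fun x ↦ w x / 2)
      (1 / (c * (1 - 27 * c)) * (-3 * realQuasiPeriod (w c) (t c) -
        1 / 4 * (1 - 36 * c) * (w c / 2))) c := by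
  obtain ⟨ht, hw⟩ := IsPeriodRatio.hasDerivAt h hc
  have hwp := (h c hc).pos
  have hc0 := hc.1
  have hc1 : 0 < 1 - 27 * c := by linarith [hc.2]
  have hc2 : 1 - c * 27 ≠ 0 := by linarith
  refine (hw.div_const 2).congr_deriv ?_
  simp only [realQuasiPeriod]
  field_simp
  ring

theorem hasDerivAt_imagHalfPeriod
    (h : ∀ c ∈ Set.Ioo (0 : ℝ) (1 / 27), IsPeriodRatio (w c) (t c) c)
    (hc : c ∈ Set.Ioo (0 : ℝ) (1 / 27)) :
    HasDerivAt (fun x ↦ t x * w x / 2)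
      (1 / (c * (1 - 27 * c)) * (-3 * imagQuasiPeriod (w c) (t c) -
        1 / 4 * (1 - 36 * c) * (t c * w c / 2))) c := by
  obtain ⟨ht, hw⟩ := IsPeriodRatio.hasDerivAt h hc
  have hwp := (h c hc).pos
  have hpi := Real.pi_pos
  have hc0 := hc.1
  have hc1 : 0 < 1 - 27 * c := by linarith [hc.2]
  have hc2 : 1 - c * 27 ≠ 0 := by linarith
  refine ((ht.mul hw).div_const 2).congr_deriv ?_
  simp only [imagQuasiPeriod, realQuasiPeriod]
  field_simp
  ring

end IsPeriodRatio

/-! ### Back to complex period pairs -/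

namespace PeriodPair

theorem isRectangularFor_iff_isPeriodRatio {L : PeriodPair} {w t c : ℝ} (hw : 0 < w) (ht : 0 < t)
    (h1 : L.ω₁ = w) (h2 : L.ω₂ = w * (I * t)) :
    L.IsRectangularFor c ↔ IsPeriodRatio w t c := by
  have h2' : L.ω₂ = L.ω₁ * (axisPoint t : ℍ) := by rw [h1, h2, coe_axisPoint ht]
  have hg2 := g₂_eq_E₄ L.ω₁_ne_zero _ (coe_latticeEquivFinTwo_of_eq h2')
  have hg3 := g₃_eq_E₆ L.ω₁_ne_zero _ (coe_latticeEquivFinTwo_of_eq h2')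
  rw [E₄_axisPoint ht, h1] at hg2
  rw [E₆_axisPoint ht, h1] at hg3
  have hw0 : (w : ℂ) ≠ 0 := by exact_mod_cast hw.ne'
  have i2 : L.g₂ = 1 / 12 - 2 * (c : ℂ) ↔
      4 * π ^ 4 / 3 * axisRe E₄ t = (1 / 12 - 2 * c) * w ^ 4 := by
    rw [hg2, div_eq_iff (pow_ne_zero 4 hw0), ← Complex.ofReal_inj]
    push_cast
    rfl
  have i3 : L.g₃ = (c : ℂ) / 6 - 1 / 216 - (c : ℂ) ^ 2 ↔
      8 * π ^ 6 / 27 * axisRe E₆ t = (c / 6 - 1 / 216 - c ^ 2) * w ^ 6 := by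
    rw [hg3, div_eq_iff (pow_ne_zero 6 hw0), ← Complex.ofReal_inj]
    push_cast
    rfl
  constructor
  · intro h
    exact ⟨hw, ht, i2.mp h.g₂_eq, i3.mp h.g₃_eq⟩
  · intro h
    exact ⟨by simp [h1], by simpa [h1] using hw, by simp [h2], by simp [h2, hw, ht],
      i2.mpr h.g₂_eq, i3.mpr h.g₃_eq⟩

/-- The rectangular period pair `w, i t w`. -/
noncomputable def rectangular (w t : ℝ) (hw : 0 < w) (ht : 0 < t) : PeriodPair where
  ω₁ := w
  ω₂ := w * (I * t)
  indep := by
    rw [LinearIndependent.pair_iff]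
    intro a b hab
    have hre := congrArg Complex.re hab
    have him := congrArg Complex.im hab
    simp at hre him
    exact ⟨hre.resolve_right hw.ne', (him.resolve_right (not_or.mpr ⟨hw.ne', ht.ne'⟩))⟩

theorem IsRectangularFor.isPeriodRatio {L : PeriodPair} {c : ℝ} (h : L.IsRectangularFor c) :
    L.ω₁ = L.ω₁.re ∧ L.ω₂ = L.ω₁.re * (I * (L.ω₂.im / L.ω₁.re : ℝ)) ∧
      IsPeriodRatio L.ω₁.re (L.ω₂.im / L.ω₁.re) c := by
  have hw := h.ω₁_re_pos
  have h1 : L.ω₁ = L.ω₁.re := Complex.ext rfl (by simp [h.ω₁_im])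
  have h2 : L.ω₂ = L.ω₁.re * (I * (L.ω₂.im / L.ω₁.re : ℝ)) := by
    refine Complex.ext ?_ ?_
    · rw [h.ω₂_re, Complex.re_ofReal_mul, Complex.I_mul_re, Complex.ofReal_im, neg_zero, mul_zero]
    · rw [Complex.im_ofReal_mul, Complex.I_mul_im, Complex.ofReal_re, mul_div_cancel₀ _ hw.ne']
  exact ⟨h1, h2, (isRectangularFor_iff_isPeriodRatio hw (div_pos h.ω₂_im_pos hw) h1 h2).mp h⟩

theorem existsUnique_isRectangularFor {c : ℝ} (hc : c ∈ Set.Ioo (0 : ℝ) (1 / 27)) :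
    ∃! L : PeriodPair, L.IsRectangularFor c := by
  obtain ⟨w, t, h⟩ := IsPeriodRatio.exists_of_mem hc
  refine ⟨rectangular w t h.pos h.ratio_pos,
    (isRectangularFor_iff_isPeriodRatio h.pos h.ratio_pos rfl rfl).mpr h, fun L hL ↦ ?_⟩
  obtain ⟨h1, h2, h'⟩ := hL.isPeriodRatio
  obtain ⟨hw, ht⟩ := h'.unique hc h
  rw [hw] at h1
  rw [ht, hw] at h2
  obtain ⟨ω₁, ω₂, _⟩ := L
  simp only [rectangular, PeriodPair.mk.injEq]
  exact ⟨h1, h2⟩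

theorem quasiPeriod_zero_eq_ofReal {L : PeriodPair} {w t : ℝ} (ht : 0 < t) (h1 : L.ω₁ = w)
    (h2 : L.ω₂ = w * (I * t)) : L.quasiPeriod 0 = realQuasiPeriod w t := by
  rw [quasiPeriod_zero_eq (z := axisPoint t) (by rw [h1, h2, coe_axisPoint ht]), E2_axisPoint ht,
    h1, realQuasiPeriod]
  push_cast
  rfl

theorem quasiPeriod_one_eq_ofReal {L : PeriodPair} {w t : ℝ} (ht : 0 < t) (h1 : L.ω₁ = w)
    (h2 : L.ω₂ = w * (I * t)) : L.quasiPeriod 1 = I * imagQuasiPeriod w t := by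
  rw [quasiPeriod_one_eq (z := axisPoint t) (by rw [h1, h2, coe_axisPoint ht]),
    quasiPeriod_zero_eq_ofReal ht h1 h2, coe_axisPoint ht, h1, imagQuasiPeriod]
  push_cast
  ring

/-- The pair with index 1 is I times a real pair; the system is linear, so the factor I passes
through. -/
theorem hasDerivAt_quasiPeriod_and_halfPeriod {L : ℝ → PeriodPair}
    (hL : ∀ c ∈ Set.Ioo (0 : ℝ) (1 / 27), (L c).IsRectangularFor c) {c : ℝ}
    (hc : c ∈ Set.Ioo (0 : ℝ) (1 / 27)) (i : Fin 2) :
    HasDerivAt (fun x ↦ (L x).quasiPeriod i)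
      (1 / ((c : ℂ) * (1 - 27 * c)) * (1 / 4 * (1 - 36 * c) * (L c).quasiPeriod i +
        1 / 48 * (1 - 24 * c) * (L c).halfPeriod i)) c ∧
    HasDerivAt (fun x ↦ (L x).halfPeriod i)
      (1 / ((c : ℂ) * (1 - 27 * c)) * (-3 * (L c).quasiPeriod i -
        1 / 4 * (1 - 36 * c) * (L c).halfPeriod i)) c := by
  set w : ℝ → ℝ := fun x ↦ (L x).ω₁.re with hw
  set t : ℝ → ℝ := fun x ↦ (L x).ω₂.im / (L x).ω₁.re with ht
  have h1 : ∀ x ∈ Set.Ioo (0 : ℝ) (1 / 27), (L x).ω₁ = w x :=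
    fun x hx ↦ (hL x hx).isPeriodRatio.1
  have h2 : ∀ x ∈ Set.Ioo (0 : ℝ) (1 / 27), (L x).ω₂ = w x * (I * t x) :=
    fun x hx ↦ (hL x hx).isPeriodRatio.2.1
  have h : ∀ x ∈ Set.Ioo (0 : ℝ) (1 / 27), IsPeriodRatio (w x) (t x) x :=
    fun x hx ↦ (hL x hx).isPeriodRatio.2.2
  have hev := Ioo_mem_nhds hc.1 hc.2
  have q0 : ∀ x ∈ Set.Ioo (0 : ℝ) (1 / 27),
      (L x).quasiPeriod 0 = (realQuasiPeriod (w x) (t x) : ℝ) :=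
    fun x hx ↦ quasiPeriod_zero_eq_ofReal (h x hx).ratio_pos (h1 x hx) (h2 x hx)
  have q1 : ∀ x ∈ Set.Ioo (0 : ℝ) (1 / 27),
      (L x).quasiPeriod 1 = I * (imagQuasiPeriod (w x) (t x) : ℝ) :=
    fun x hx ↦ quasiPeriod_one_eq_ofReal (h x hx).ratio_pos (h1 x hx) (h2 x hx)
  have p0 : ∀ x ∈ Set.Ioo (0 : ℝ) (1 / 27), (L x).halfPeriod 0 = (w x / 2 : ℝ) := by
    intro x hx
    simp [halfPeriod, h1 x hx]
  have p1 : ∀ x ∈ Set.Ioo (0 : ℝ) (1 / 27), (L x).halfPeriod 1 = I * (t x * w x / 2 : ℝ) := by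
    intro x hx
    simp only [halfPeriod, Matrix.cons_val_one, h2 x hx]
    push_cast
    ring
  fin_cases i
  · refine ⟨((IsPeriodRatio.hasDerivAt_realQuasiPeriod h hc).ofReal_comp.congr_of_eventuallyEq
      (by filter_upwards [hev] with x hx using q0 x hx)).congr_deriv ?_,
      ((IsPeriodRatio.hasDerivAt_realHalfPeriod h hc).ofReal_comp.congr_of_eventuallyEq
      (by filter_upwards [hev] with x hx using p0 x hx)).congr_deriv ?_⟩ <;>
    · simp only [Fin.zero_eta, q0 c hc, p0 c hc]
      push_cast
      ring
  · refine ⟨(((IsPeriodRatio.hasDerivAt_imagQuasiPeriod h hc).ofReal_comp.const_mul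
      I).congr_of_eventuallyEq
      (by filter_upwards [hev] with x hx using q1 x hx)).congr_deriv ?_,
      (((IsPeriodRatio.hasDerivAt_imagHalfPeriod h hc).ofReal_comp.const_mul
      I).congr_of_eventuallyEq
      (by filter_upwards [hev] with x hx using p1 x hx)).congr_deriv ?_⟩ <;>
    · simp only [Fin.mk_one, q1 c hc, p1 c hc]
      push_cast
      ring

end PeriodPair

end RectangularLattices

theorem mainTheorem10 :
    (∀ c ∈ Set.Ioo (0 : ℝ) (1 / 27), ∃! L : PeriodPair, L.IsRectangularFor c) ∧
    (∀ c ∈ Set.Ioo (0 : ℝ) (1 / 27), (periodMatrix c).trace = 0) ∧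
    ∀ L : ℝ → PeriodPair, (∀ c ∈ Set.Ioo (0 : ℝ) (1 / 27), (L c).IsRectangularFor c) →
      ∀ c ∈ Set.Ioo (0 : ℝ) (1 / 27), ∀ i : Fin 2,
        HasDerivAt (fun x : ℝ => ![(L x).quasiPeriod i, (L x).halfPeriod i])
          (Matrix.mulVec (periodMatrix c) ![(L c).quasiPeriod i, (L c).halfPeriod i]) c ∧
        HasDerivAt (fun x : ℝ => (L x).modifiedQuasiPeriod x i)
          (-2 * (L c).halfPeriod i) c ∧
        HasDerivAt (fun x : ℝ => (L x).halfPeriod i)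
          (-3 * (L c).modifiedQuasiPeriod c i / ((c : ℂ) * (1 - 27 * (c : ℂ)))) c := by
  refine ⟨fun c hc ↦ PeriodPair.existsUnique_isRectangularFor hc, fun c _ ↦ ?_,
    fun L hL c hc i ↦ ?_⟩
  · simp [periodMatrix, Matrix.trace_fin_two]
  obtain ⟨hη, hω⟩ := PeriodPair.hasDerivAt_quasiPeriod_and_halfPeriod hL hc i
  have hc0 : (c : ℂ) ≠ 0 := by exact_mod_cast hc.1.ne'
  have hc1 : (1 - 27 * (c : ℂ)) ≠ 0 := by
    have : (1 - 27 * c : ℝ) ≠ 0 := by linarith [hc.2]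
    exact_mod_cast this
  have hc2 : (1 - (c : ℂ) * 27) ≠ 0 := by rwa [mul_comm]
  have hid : HasDerivAt (fun x : ℝ ↦ 1 / 12 - 3 * (x : ℂ)) (-(3 * 1)) c :=
    (((hasDerivAt_id c).ofReal_comp).const_mul 3).const_sub (1 / 12)
  -- Since (1 - 36c)/4 = 3(1/12 - 3c), the row for ω is -3η̃ and the diagonal terms disappear.
  refine ⟨hasDerivAt_pi.mpr fun j ↦ ?_, (hη.add (hω.mul hid)).congr_deriv ?_,
    hω.congr_deriv ?_⟩
  · fin_cases j
    · refine hη.congr_deriv ?_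
      simp [periodMatrix, Matrix.mulVec, dotProduct, Fin.sum_univ_two]
      ring
    · refine hω.congr_deriv ?_
      simp [periodMatrix, Matrix.mulVec, dotProduct, Fin.sum_univ_two]
      ring
  · field_simp
    ring
  · rw [PeriodPair.modifiedQuasiPeriod]
    field_simp
    ring
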